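/- Let $\vartheta\in(0,\infty)$ and $d\in\mathbb N=\{1,2,\dots\}$, and let $\ell\colon\mathbb R^d\times\mathbb R^d\to\mathbb R$ be the quadratic loss $\ell(\theta,x)=\tfrac{\vartheta}{2}\|\theta-x\|^2$, where $\|\cdot\|$ is the Euclidean norm. Let $(\Omega,\mathcal F,(\mathbb F_n)_{n\in\mathbb N_0},\mathbb P)$ be a filtered probability space. For every $n\in\mathbb N$ let $\gamma_n\colon\Omega\to\mathbb R$ be $\mathbb F_{n-1}$-measurable, and assume $$\mathbb P\Bigl(\limsup_{n\to\infty}\gamma_n=0\Bigr)=\mathbb P\Bigl(\sum_{n=1}^\infty|\gamma_n|=\infty\Bigr)=1,\qquad \mathbb P\bigl(\gamma_{n+1}\le\gamma_n\le\vartheta^{-1}\bigr)=1\quad\text{for all }n\in\mathbb N.$$ Let $M\in\mathbb N$, and let $X_{n,m}\colon\Omega\to\mathbb R^d$, $(n,m)\in\mathbb N\times\{1,\dots,M\}$, be i.i.d. random variables such that for all $n\in\mathbb N$ and $m\in\{1,\dots,M\}$ the random variable $X_{n,m}$ is $\mathbb F_n$-measurable, and such that for all $n\in\mathbb N$ the $\sigma$-algebras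 $\sigma((X_{n,m})_{m\in\{1,\dots,M\}})$ and $\mathbb F_{n-1}$ are independent. Let $\Theta\colon\mathbb N_0\times\Omega\to\mathbb R^d$ be an $(\mathbb F_n)_{n\in\mathbb N_0}$-adapted stochastic process which satisfies for all $n\in\mathbb N$ that $$\Theta_n=\Theta_{n-1}-\frac{\gamma_n}{M}\sum_{m=1}^M(\nabla_\theta\ell)(\Theta_{n-1},X_{n,m}).$$ Assume $\mathbb E\bigl[\|\Theta_0\|^2+\sup_{n\in\mathbb N}\|X_{n,1}\|\bigr]<\infty$. For every $t\in[0,\infty)$ let $N_t\colon\Omega\to\mathbb N_0$ satisfy $$N_t=\inf\Bigl\{n\in\mathbb N_0\colon\sum_{k=1}^n\gamma_k\ge t\Bigr\}$$ at every point of $\Omega$ where this set is non-empty (the values of $N_t$ elsewhere, which is a $\mathbb P$-null event, are arbitrary). Then $X_{1,1}$ is integrable, $\mathbb E\bigl[\|\Theta_{N_t}-\mathbb E[X_{1,1}]\|^2\bigr]<\infty$ for all $t\in[0,\infty)$, and $$\limsup_{t\to\infty}\mathbb E\bigl[\|\Theta_{N_t}-\mathbb E[X_{1,1}]\|^2\bigr]=0.$$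 -/

import Mathlib

open Filter MeasureTheory ProbabilityTheory
open scoped Topology

/-! Put `a n = ϑ γ (n + 1)` and let `D n` be the error `Θ n - E[X]`. Since the gradient is linear,
`D (n + 1) = (1 - a n) D n + a n Y n`, with `Y n` the centered mini-batch mean, independent of the
past. Integrability of the supremum forces i.i.d. data to be essentially bounded, so `‖Y n‖ ≤ C`.

Switching the steps off once their sum reaches `s` freezes the process at the hitting time and
leaves the steps predictable. Call them `b`, with partial sums `B`. As `e^b (1 - b)^2 ≤ 1` and the
cross terms have mean zero, `E[e^(B n) ‖D n‖^2]` is at most `E‖D 0‖^2 + C^2 E[∑ e^(B (k+1)) (b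
k)^2]`. The sums are random, so the exponential weight has to stay inside the expectation.

Pathwise, by monotonicity of the steps, the weighted sum is at most `K e^K + e^(s+2) a K` for every
`K`. At the hitting time the weight is at least `e^s`; dividing by it leaves a term that vanishes as
`s → ∞` for fixed `K`, plus `C^2 e^2 E[a K]`, which is small for large `K` by dominated convergence.
-/

/-- The gradient of a quadratic loss. -/
theorem gradient_half_mul_norm_sub_sq {E : Type*} [NormedAddCommGroup E] [InnerProductSpace ℝ E]
    [CompleteSpace E] (c : ℝ) (x θ : E) :
    gradient (fun y => c / 2 * ‖y - x‖ ^ 2) θ = c • (θ - x) := by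
  apply HasGradientAt.gradient
  rw [hasGradientAt_iff_hasFDerivAt]
  have h := (((hasFDerivAt_id (𝕜 := ℝ) θ).sub_const x).norm_sq).const_mul (c / 2)
  refine h.congr_fderiv ?_
  ext v
  simp
  ring

/-! ### Essential boundedness of the data -/

/-- An i.i.d. sequence whose supremum is integrable is essentially bounded. -/
theorem exists_ae_norm_le_of_lintegral_iSup_lt_top {Ω E : Type*} {mΩ : MeasurableSpace Ω}
    {P : Measure Ω} [IsProbabilityMeasure P] [NormedAddCommGroup E] [MeasurableSpace E]
    [OpensMeasurableSpace E] {X : ℕ → Ω → E} (hindep : iIndepFun X P)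
    (hident : ∀ n, IdentDistrib (X n) (X 0) P P)
    (hsup : ∫⁻ ω, ⨆ n, ENNReal.ofReal ‖X n ω‖ ∂P < ⊤) :
    ∃ C : ℝ, 0 ≤ C ∧ ∀ᵐ ω ∂P, ‖X 0 ω‖ ≤ C := by
  -- One more than the mean supremum: if `‖X 0‖ > K` had positive probability, independence would
  -- push the supremum above `K` almost surely, and its mean would be at least `K`.
  set K : ℝ := (∫⁻ ω, ⨆ n, ENNReal.ofReal ‖X n ω‖ ∂P).toReal + 1 with hK
  have hKpos : 0 ≤ K := by positivity
  refine ⟨K, hKpos, ?_⟩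
  have hs : MeasurableSet {x : E | ‖x‖ ≤ K} := measurableSet_le measurable_norm measurable_const
  have hnull : NullMeasurableSet {ω | ‖X 0 ω‖ ≤ K} P :=
    (hident 0).aemeasurable_fst.nullMeasurable hs
  by_contra hcon
  have hp : P {ω | ‖X 0 ω‖ ≤ K} < 1 := by
    refine lt_of_le_of_ne prob_le_one fun h => hcon ?_
    exact (prob_compl_eq_zero_iff₀ hnull).2 h
  have hm : ∀ m : ℕ, P {ω | ∀ n, ‖X n ω‖ ≤ K} ≤ P {ω | ‖X 0 ω‖ ≤ K} ^ m := by
    intro m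
    have h := hindep.measure_inter_preimage_eq_mul (Finset.range m)
      (sets := fun _ => {x : E | ‖x‖ ≤ K}) (fun _ _ => hs)
    have h' : ∀ i ∈ Finset.range m, P (X i ⁻¹' {x : E | ‖x‖ ≤ K}) = P {ω | ‖X 0 ω‖ ≤ K} :=
      fun i _ => (hident i).measure_mem_eq hs
    rw [Finset.prod_congr rfl h', Finset.prod_const, Finset.card_range] at h
    rw [← h]
    refine measure_mono fun ω hω => ?_
    simp only [Set.mem_iInter]
    exact fun i _ => hω i
  have h0 : P {ω | ∀ n, ‖X n ω‖ ≤ K} = 0 :=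
    le_antisymm (ge_of_tendsto' (ENNReal.tendsto_pow_atTop_nhds_zero_of_lt_one hp) hm) zero_le
  have hae : ∀ᵐ ω ∂P, ENNReal.ofReal K ≤ ⨆ n, ENNReal.ofReal ‖X n ω‖ := by
    have : ∀ᵐ ω ∂P, ¬ ∀ n, ‖X n ω‖ ≤ K := by
      rw [ae_iff]; simpa using h0
    filter_upwards [this] with ω hω
    push Not at hω
    obtain ⟨n, hn⟩ := hω
    exact (ENNReal.ofReal_le_ofReal hn.le).trans (le_iSup (fun n => ENNReal.ofReal ‖X n ω‖) n)
  have hle : ENNReal.ofReal K ≤ ∫⁻ ω, ⨆ n, ENNReal.ofReal ‖X n ω‖ ∂P := by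
    simpa using lintegral_mono_ae hae
  have := (ENNReal.ofReal_le_iff_le_toReal hsup.ne).1 hle
  linarith

/-! ### Pathwise estimates for stopped steps -/

/-- The steps `a` switched off as soon as their sum has reached `s`. -/
noncomputable def stoppedStep (a : ℕ → ℝ) (s : ℝ) (k : ℕ) : ℝ :=
  if ∑ j ∈ Finset.range k, a j < s then a k else 0

theorem stoppedStep_nonneg {a : ℕ → ℝ} (h0 : ∀ n, 0 ≤ a n) (s : ℝ) (k : ℕ) :
    0 ≤ stoppedStep a s k := by
  unfold stoppedStep; split_ifs <;> simp [h0]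

theorem stoppedStep_le {a : ℕ → ℝ} (h0 : ∀ n, 0 ≤ a n) (s : ℝ) (k : ℕ) :
    stoppedStep a s k ≤ a k := by
  unfold stoppedStep; split_ifs <;> simp [h0]

/-- The last active step starts from a sum below `s`, so the overshoot is at most one step. -/
theorem sum_stoppedStep_le {a : ℕ → ℝ} (h0 : ∀ n, 0 ≤ a n) (h1 : ∀ n, a n ≤ 1) {s : ℝ}
    (hs : 0 ≤ s) (n : ℕ) : ∑ k ∈ Finset.range n, stoppedStep a s k ≤ s + 1 := by
  induction n with
  | zero => simp; linarith
  | succ n ih =>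
    rw [Finset.sum_range_succ]
    by_cases h : ∑ j ∈ Finset.range n, a j < s
    · have h2 : ∑ k ∈ Finset.range n, stoppedStep a s k ≤ ∑ j ∈ Finset.range n, a j :=
        Finset.sum_le_sum fun k _ => stoppedStep_le h0 s k
      have := stoppedStep_le h0 s n
      linarith [h1 n]
    · have : stoppedStep a s n = 0 := by simp [stoppedStep, h]
      linarith

/-- The sum of the stopped steps is eventually at least `s`. -/
theorem le_sum_stoppedStep {a : ℕ → ℝ} (h0 : ∀ n, 0 ≤ a n) {s : ℝ} {n : ℕ}
    (hn : s ≤ ∑ k ∈ Finset.range n, a k) :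
    s ≤ ∑ k ∈ Finset.range n, stoppedStep a s k := by
  induction n with
  | zero => simpa using hn
  | succ n ih =>
    by_cases h : ∑ j ∈ Finset.range n, a j < s
    · have : ∀ k ∈ Finset.range (n + 1), stoppedStep a s k = a k := by
        intro k hk
        have hle : ∑ j ∈ Finset.range k, a j ≤ ∑ j ∈ Finset.range n, a j :=
          Finset.sum_le_sum_of_subset_of_nonneg
            (Finset.range_mono (by simpa [Nat.lt_succ_iff] using hk)) fun i _ _ => h0 i
        simp [stoppedStep, hle.trans_lt h]
      rwa [Finset.sum_congr rfl this]
    · rw [Finset.sum_range_succ]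
      have := ih (not_lt.1 h)
      linarith [stoppedStep_nonneg h0 s n]

/-- The exponentially weighted sum of the squared stopped steps. -/
theorem sum_exp_mul_stoppedStep_sq_le {a : ℕ → ℝ} (h0 : ∀ n, 0 ≤ a n) (h1 : ∀ n, a n ≤ 1)
    (ha : Antitone a) {s : ℝ} (hs : 0 ≤ s) (K n : ℕ) :
    ∑ k ∈ Finset.range n,
        Real.exp (∑ j ∈ Finset.range (k + 1), stoppedStep a s j) * stoppedStep a s k ^ 2
      ≤ K * Real.exp K + Real.exp (s + 2) * a K := by
  set b := stoppedStep a s with hb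
  have hb0 : ∀ k, 0 ≤ b k := stoppedStep_nonneg h0 s
  have hba : ∀ k, b k ≤ a k := stoppedStep_le h0 s
  set B : ℕ → ℝ := fun n => ∑ j ∈ Finset.range n, b j with hB
  -- Early terms are bounded crudely, since `B (k + 1) ≤ K`. For later ones `b k ≤ a K` and `e^(b k)
  -- ≤ e`, and the remaining `e^(B k) b k` is dominated by a telescoping increment.
  have hterm : ∀ k, Real.exp (B (k + 1)) * b k ^ 2 ≤
      (if k < K then Real.exp K else 0)
        + a K * Real.exp 1 * (Real.exp (B (k + 1)) - Real.exp (B k)) := by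
    intro k
    have hBs : B (k + 1) = B k + b k := Finset.sum_range_succ _ _
    have hb1 : b k ≤ 1 := (hba k).trans (h1 k)
    have hinc : Real.exp (B k) * b k ≤ Real.exp (B (k + 1)) - Real.exp (B k) := by
      rw [hBs, Real.exp_add]
      nlinarith [Real.add_one_le_exp (b k), Real.exp_pos (B k)]
    have hinc0 : 0 ≤ Real.exp (B k) * b k := mul_nonneg (Real.exp_pos _).le (hb0 k)
    have hae : 0 ≤ a K * Real.exp 1 := mul_nonneg (h0 K) (Real.exp_pos _).le
    split_ifs with hk
    · have hBk : B (k + 1) ≤ K := by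
        have : B (k + 1) ≤ ∑ _j ∈ Finset.range (k + 1), (1 : ℝ) :=
          Finset.sum_le_sum fun j _ => (hba j).trans (h1 j)
        simp only [Finset.sum_const, Finset.card_range, nsmul_eq_mul, mul_one] at this
        exact this.trans (by exact_mod_cast hk)
      have h3 : Real.exp (B (k + 1)) * b k ^ 2 ≤ Real.exp K * 1 :=
        mul_le_mul (Real.exp_le_exp.2 hBk) (pow_le_one₀ (hb0 k) hb1) (sq_nonneg _)
          (Real.exp_pos _).le
      have := mul_nonneg hae (hinc0.trans hinc)
      linarith
    · have hbK : b k ≤ a K := (hba k).trans (ha (not_lt.1 hk))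
      rw [zero_add]
      calc Real.exp (B (k + 1)) * b k ^ 2
          = b k * Real.exp (b k) * (Real.exp (B k) * b k) := by rw [hBs, Real.exp_add]; ring
        _ ≤ a K * Real.exp 1 * (Real.exp (B k) * b k) := by
            gcongr
            exact h0 K
        _ ≤ _ := by gcongr
  calc ∑ k ∈ Finset.range n, Real.exp (B (k + 1)) * b k ^ 2
      ≤ ∑ k ∈ Finset.range n, ((if k < K then Real.exp K else 0)
        + a K * Real.exp 1 * (Real.exp (B (k + 1)) - Real.exp (B k))) :=
        Finset.sum_le_sum fun k _ => hterm k
    _ = (∑ k ∈ Finset.range n, if k < K then Real.exp K else 0)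
        + a K * Real.exp 1 * (Real.exp (B n) - Real.exp (B 0)) := by
        rw [Finset.sum_add_distrib, ← Finset.mul_sum,
          Finset.sum_range_sub (fun k => Real.exp (B k))]
    _ ≤ K * Real.exp K + a K * Real.exp 1 * Real.exp (s + 1) := by
        have h4 : B n ≤ s + 1 := sum_stoppedStep_le h0 h1 hs n
        have hae : 0 ≤ a K * Real.exp 1 := mul_nonneg (h0 K) (Real.exp_pos _).le
        refine add_le_add ?_ (mul_le_mul_of_nonneg_left ?_ hae)
        · rw [← Finset.sum_filter, Finset.sum_const, nsmul_eq_mul]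
          gcongr
          calc _ ≤ (Finset.range K).card := Finset.card_le_card fun k hk => by
                simp at hk ⊢; exact hk.2
            _ = K := Finset.card_range K
        · have := Real.exp_le_exp.2 h4
          linarith [Real.exp_pos (B 0)]
    _ = K * Real.exp K + Real.exp (s + 2) * a K := by
        rw [show s + 2 = 1 + (s + 1) by ring, Real.exp_add 1]; ring

/-! ### Weighted second moments of the averaging recursion -/

/-- The recursion `D (n + 1) = (1 - b n) D n + b n Y n`. -/
noncomputable def averagingSeq {Ω E : Type*} [NormedAddCommGroup E] [InnerProductSpace ℝ E]
    (b : ℕ → Ω → ℝ) (Y : ℕ → Ω → E) (D₀ : Ω → E) : ℕ → Ω → E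
  | 0 => D₀
  | n + 1 => fun ω => (1 - b n ω) • averagingSeq b Y D₀ n ω + b n ω • Y n ω

section AveragingSeq

variable {Ω E : Type*} [NormedAddCommGroup E] [InnerProductSpace ℝ E]
  {b : ℕ → Ω → ℝ} {Y : ℕ → Ω → E} {D₀ : Ω → E}

/-- Each iterate is a convex combination of the previous one and a vector of norm at most `C`. The
bound is uniform in `n` and serves for domination. -/
theorem averagingSeq_norm_le {C : ℝ} (hC : 0 ≤ C) {ω : Ω} (hb0 : ∀ n, 0 ≤ b n ω)
    (hb1 : ∀ n, b n ω ≤ 1) (hY : ∀ n, ‖Y n ω‖ ≤ C) (n : ℕ) :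
    ‖averagingSeq b Y D₀ n ω‖ ≤ ‖D₀ ω‖ + C := by
  induction n with
  | zero => simpa [averagingSeq] using hC
  | succ n ih =>
    have h1 : 0 ≤ 1 - b n ω := sub_nonneg.2 (hb1 n)
    calc ‖averagingSeq b Y D₀ (n + 1) ω‖
        ≤ (1 - b n ω) * ‖averagingSeq b Y D₀ n ω‖ + b n ω * ‖Y n ω‖ := by
          refine (norm_add_le _ _).trans_eq ?_
          rw [norm_smul, norm_smul, Real.norm_of_nonneg h1, Real.norm_of_nonneg (hb0 n)]
      _ ≤ (1 - b n ω) * (‖D₀ ω‖ + C) + b n ω * (‖D₀ ω‖ + C) :=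
          add_le_add (mul_le_mul_of_nonneg_left ih h1)
            (mul_le_mul_of_nonneg_left ((hY n).trans (by linarith [norm_nonneg (D₀ ω)])) (hb0 n))
      _ = ‖D₀ ω‖ + C := by ring

variable {mΩ : MeasurableSpace Ω} {P : Measure Ω} [IsProbabilityMeasure P] {𝔽 : Filtration ℕ mΩ}
  [SecondCountableTopology E] [MeasurableSpace E] [BorelSpace E]

theorem measurable_averagingSeq (hb : ∀ n, Measurable[𝔽 n] (b n))
    (hY : ∀ n, Measurable[𝔽 (n + 1)] (Y n)) (hD₀ : Measurable[𝔽 0] D₀) (n : ℕ) :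
    Measurable[𝔽 n] (averagingSeq b Y D₀ n) := by
  induction n with
  | zero => exact hD₀
  | succ n ih =>
    have hle : 𝔽 n ≤ 𝔽 (n + 1) := 𝔽.mono n.le_succ
    have hb' : Measurable[𝔽 (n + 1)] (b n) := (hb n).mono hle le_rfl
    have hD' : Measurable[𝔽 (n + 1)] (averagingSeq b Y D₀ n) := ih.mono hle le_rfl
    exact ((measurable_const.sub hb').smul hD').add (hb'.smul (hY n))

/-- Weighted second moment estimate for the averaging process with predictable weights and centered
bounded innovations. -/
theorem integral_exp_mul_norm_averagingSeq_sq_le [CompleteSpace E] {C : ℝ} (hC : 0 ≤ C)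
    (hb : ∀ n, Measurable[𝔽 n] (b n)) (hb0 : ∀ n ω, 0 ≤ b n ω) (hb1 : ∀ n ω, b n ω ≤ 1)
    (hY : ∀ n, Measurable[𝔽 (n + 1)] (Y n)) (hYC : ∀ᵐ ω ∂P, ∀ n, ‖Y n ω‖ ≤ C)
    (hY0 : ∀ n, ∫ ω, Y n ω ∂P = 0)
    (hindep : ∀ n, Indep (MeasurableSpace.comap (Y n) inferInstance) (𝔽 n) P)
    (hD₀ : Measurable[𝔽 0] D₀) (hD₀2 : Integrable (fun ω => ‖D₀ ω‖ ^ 2) P)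
    (n : ℕ) :
    ∫ ω, Real.exp (∑ k ∈ Finset.range n, b k ω) * ‖averagingSeq b Y D₀ n ω‖ ^ 2 ∂P
      ≤ ∫ ω, ‖D₀ ω‖ ^ 2 ∂P + C ^ 2 * ∫ ω, ∑ k ∈ Finset.range n,
        Real.exp (∑ j ∈ Finset.range (k + 1), b j ω) * b k ω ^ 2 ∂P := by
  set D := averagingSeq b Y D₀ with hD
  set B : ℕ → Ω → ℝ := fun n ω => ∑ k ∈ Finset.range n, b k ω with hB
  have hDm : ∀ n, Measurable[𝔽 n] (D n) := measurable_averagingSeq hb hY hD₀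
  have hbm : ∀ n, Measurable (b n) := fun n => (hb n).mono (𝔽.le n) le_rfl
  have hBm' : ∀ n, Measurable[𝔽 n] (B (n + 1)) := fun n =>
    Finset.measurable_fun_sum _ fun k hk => (hb k).mono
      (𝔽.mono (Nat.lt_succ_iff.1 (Finset.mem_range.1 hk))) le_rfl
  have hBm : ∀ n, Measurable (B n) := fun n => Finset.measurable_fun_sum _ fun k _ => hbm k
  have hBn : ∀ n ω, B n ω ≤ n := fun n ω => by
    have : B n ω ≤ ∑ _j ∈ Finset.range n, (1 : ℝ) := Finset.sum_le_sum fun j _ => hb1 j ω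
    simpa using this
  have hDb : ∀ᵐ ω ∂P, ∀ n, ‖D n ω‖ ≤ ‖D₀ ω‖ + C := by
    filter_upwards [hYC] with ω hω n
    exact averagingSeq_norm_le hC (fun n => hb0 n ω) (fun n => hb1 n ω) hω n
  have hD₀m : Measurable D₀ := hD₀.mono (𝔽.le 0) le_rfl
  have hD₀L : MemLp D₀ 2 P := (memLp_two_iff_integrable_sq_norm hD₀m.aestronglyMeasurable).2 hD₀2
  have hGL : MemLp (fun ω => ‖D₀ ω‖ + C) 2 P := hD₀L.norm.add (memLp_const C)
  have hDmeas : ∀ n, Measurable (D n) := fun n => (hDm n).mono (𝔽.le n) le_rfl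
  have hDL : ∀ n, MemLp (D n) 2 P := fun n => hGL.mono (hDmeas n).aestronglyMeasurable <| by
    filter_upwards [hDb] with ω hω
    exact (hω n).trans (Real.le_norm_self _)
  have hYm : ∀ n, Measurable (Y n) := fun n => (hY n).mono (𝔽.le _) le_rfl
  have hYi : ∀ n, Integrable (Y n) P := fun n =>
    Integrable.of_bound (hYm n).aestronglyMeasurable C (hYC.mono fun ω h => h n)
  have hU : ∀ n, Integrable (fun ω => Real.exp (B n ω) * ‖D n ω‖ ^ 2) P := fun n =>
    (hDL n).integrable_norm_pow two_ne_zero |>.bdd_mul (c := Real.exp n)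
      (hBm n).exp.aestronglyMeasurable (ae_of_all _ fun ω => by
        rw [Real.norm_of_nonneg (Real.exp_pos _).le]; exact Real.exp_le_exp.2 (hBn n ω))
  have hV : ∀ n, Integrable (fun ω => Real.exp (B (n + 1) ω) * b n ω ^ 2) P := fun n =>
    Integrable.of_bound (C := Real.exp (n + 1 : ℕ))
      ((hBm _).exp.mul ((hbm n).pow_const 2)).aestronglyMeasurable (ae_of_all _ fun ω => by
        rw [Real.norm_of_nonneg (by positivity)]
        calc _ ≤ Real.exp (n + 1 : ℕ) * 1 := mul_le_mul (Real.exp_le_exp.2 (hBn _ ω))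
              (pow_le_one₀ (hb0 n ω) (hb1 n ω)) (sq_nonneg _) (Real.exp_pos _).le
          _ = _ := mul_one _)
  have hstep : ∀ n, ∫ ω, Real.exp (B (n + 1) ω) * ‖D (n + 1) ω‖ ^ 2 ∂P
      ≤ ∫ ω, Real.exp (B n ω) * ‖D n ω‖ ^ 2 ∂P
        + C ^ 2 * ∫ ω, Real.exp (B (n + 1) ω) * b n ω ^ 2 ∂P := by
    intro n
    -- Predictability makes `B (n + 1)`, hence the whole factor `c • D n` of the cross term, `𝔽
    -- n`-measurable and so independent of the centered `Y n`.
    set c : Ω → ℝ := fun ω => 2 * Real.exp (B (n + 1) ω) * (b n ω * (1 - b n ω)) with hc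
    have hcm : Measurable[𝔽 n] c :=
      (measurable_const.mul (Real.measurable_exp.comp (hBm' n))).mul
        ((hb n).mul (measurable_const.sub (hb n)))
    have hZm : Measurable[𝔽 n] (fun ω => c ω • D n ω) := hcm.smul (hDm n)
    have hcb : ∀ ω, ‖c ω‖ ≤ 2 * Real.exp (n + 1 : ℕ) := fun ω => by
      have h1 : 0 ≤ 1 - b n ω := sub_nonneg.2 (hb1 n ω)
      have h2 := hb0 n ω
      rw [Real.norm_of_nonneg (by positivity)]
      calc c ω ≤ 2 * Real.exp (n + 1 : ℕ) * 1 :=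
            mul_le_mul (mul_le_mul_of_nonneg_left (Real.exp_le_exp.2 (hBn _ ω)) zero_le_two)
              (by nlinarith [hb1 n ω]) (by positivity) (by positivity)
        _ = _ := mul_one _
    have hZi : Integrable (fun ω => c ω • D n ω) P :=
      ((hDL n).integrable (by norm_num)).bdd_smul _
        (hcm.mono (𝔽.le n) le_rfl).aestronglyMeasurable (ae_of_all _ hcb)
    have hind : IndepFun (fun ω => c ω • D n ω) (Y n) P := by
      rw [IndepFun_iff_Indep]
      exact indep_of_indep_of_le_left (hindep n).symm hZm.comap_le
    have hcross : ∫ ω, inner ℝ (c ω • D n ω) (Y n ω) ∂P = 0 := by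
      have := hind.integral_bilin hZi (hYi n) (innerSL ℝ)
      rwa [hY0 n, map_zero] at this
    have hcrossi : Integrable (fun ω => inner ℝ (c ω • D n ω) (Y n ω)) P :=
      hind.integrable_bilin hZi (hYi n) (innerSL ℝ)
    have hpt : ∀ᵐ ω ∂P, Real.exp (B (n + 1) ω) * ‖D (n + 1) ω‖ ^ 2 ≤
        (Real.exp (B n ω) * ‖D n ω‖ ^ 2 + C ^ 2 * (Real.exp (B (n + 1) ω) * b n ω ^ 2))
          + inner ℝ (c ω • D n ω) (Y n ω) := by
      filter_upwards [hYC] with ω hω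
      have h1 : 0 ≤ 1 - b n ω := sub_nonneg.2 (hb1 n ω)
      have h2 := hb0 n ω
      have hDs : D (n + 1) ω = (1 - b n ω) • D n ω + b n ω • Y n ω := rfl
      have hBs : B (n + 1) ω = B n ω + b n ω := Finset.sum_range_succ _ _
      -- The contraction of one step pays for the growth of the weight.
      have hexp : Real.exp (b n ω) * (1 - b n ω) ^ 2 ≤ 1 := by
        have h3 : 1 - b n ω ≤ Real.exp (-b n ω) := by linarith [Real.add_one_le_exp (-b n ω)]
        have h4 : Real.exp (b n ω) * (1 - b n ω) ≤ 1 := by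
          calc _ ≤ Real.exp (b n ω) * Real.exp (-b n ω) := by gcongr
            _ = 1 := by rw [← Real.exp_add]; simp
        have h5 : 0 ≤ Real.exp (b n ω) * (1 - b n ω) := by positivity
        nlinarith
      have hY2 : ‖Y n ω‖ ^ 2 ≤ C ^ 2 := pow_le_pow_left₀ (norm_nonneg _) (hω n) 2
      have hnorm : ‖D (n + 1) ω‖ ^ 2 = (1 - b n ω) ^ 2 * ‖D n ω‖ ^ 2
          + 2 * ((1 - b n ω) * b n ω * inner ℝ (D n ω) (Y n ω)) + b n ω ^ 2 * ‖Y n ω‖ ^ 2 := by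
        rw [hDs, norm_add_sq_real, norm_smul, norm_smul, real_inner_smul_left,
          real_inner_smul_right, Real.norm_of_nonneg h1, Real.norm_of_nonneg h2]
        ring
      have hA : Real.exp (B (n + 1) ω) * ((1 - b n ω) ^ 2 * ‖D n ω‖ ^ 2) ≤
          Real.exp (B n ω) * ‖D n ω‖ ^ 2 := by
        rw [hBs, Real.exp_add]
        calc _ = Real.exp (b n ω) * (1 - b n ω) ^ 2 * (Real.exp (B n ω) * ‖D n ω‖ ^ 2) := by ring
          _ ≤ 1 * (Real.exp (B n ω) * ‖D n ω‖ ^ 2) :=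
              mul_le_mul_of_nonneg_right hexp (by positivity)
          _ = _ := one_mul _
      have hA2 : Real.exp (B (n + 1) ω) * (b n ω ^ 2 * ‖Y n ω‖ ^ 2) ≤
          C ^ 2 * (Real.exp (B (n + 1) ω) * b n ω ^ 2) := by
        calc _ = Real.exp (B (n + 1) ω) * b n ω ^ 2 * ‖Y n ω‖ ^ 2 := by ring
          _ ≤ Real.exp (B (n + 1) ω) * b n ω ^ 2 * C ^ 2 :=
              mul_le_mul_of_nonneg_left hY2 (by positivity)
          _ = _ := by ring
      rw [hnorm, real_inner_smul_left]
      simp only [hc]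
      linarith
    have h6 : Integrable (fun ω => Real.exp (B n ω) * ‖D n ω‖ ^ 2
        + C ^ 2 * (Real.exp (B (n + 1) ω) * b n ω ^ 2)) P :=
      (hU n).add ((hV n).const_mul (C ^ 2))
    calc _ ≤ ∫ ω, ((Real.exp (B n ω) * ‖D n ω‖ ^ 2
            + C ^ 2 * (Real.exp (B (n + 1) ω) * b n ω ^ 2))
          + inner ℝ (c ω • D n ω) (Y n ω)) ∂P :=
          integral_mono_ae (hU (n + 1)) (h6.add hcrossi) hpt
      _ = _ := by
          rw [integral_add h6 hcrossi, hcross, add_zero,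
            integral_add (hU n) ((hV n).const_mul _), integral_const_mul]
  induction n with
  | zero => simp [hD, averagingSeq]
  | succ n ih =>
    have h7 : ∫ ω, ∑ k ∈ Finset.range (n + 1), Real.exp (B (k + 1) ω) * b k ω ^ 2 ∂P
        = ∫ ω, ∑ k ∈ Finset.range n, Real.exp (B (k + 1) ω) * b k ω ^ 2 ∂P
          + ∫ ω, Real.exp (B (n + 1) ω) * b n ω ^ 2 ∂P := by
      rw [← integral_add (integrable_finsetSum _ fun k _ => hV k) (hV n)]
      simp only [Finset.sum_range_succ]
    refine (hstep n).trans ?_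
    change _ ≤ _ + C ^ 2 * ∫ ω, ∑ k ∈ Finset.range (n + 1), Real.exp (B (k + 1) ω) * b k ω ^ 2 ∂P
    rw [h7, mul_add, ← add_assoc]
    exact add_le_add_left ih _

end AveragingSeq

/-! ### Second moment at the hitting time -/

section Stopping

variable {Ω E : Type*} [NormedAddCommGroup E] [InnerProductSpace ℝ E]

/-- Stopping the steps stops the process. -/
theorem averagingSeq_stoppedStep_eq {a : ℕ → Ω → ℝ} {Y D : ℕ → Ω → E} {s : ℝ} {ω : Ω} {N : ℕ}
    (h0 : ∀ n, 0 ≤ a n ω)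
    (hD : ∀ n, D (n + 1) ω = (1 - a n ω) • D n ω + a n ω • Y n ω)
    (hlt : ∀ n < N, ∑ j ∈ Finset.range n, a j ω < s) (hN : s ≤ ∑ j ∈ Finset.range N, a j ω)
    (n : ℕ) :
    averagingSeq (fun k ω => stoppedStep (fun j => a j ω) s k) Y (D 0) n ω
      = D (min n N) ω := by
  induction n with
  | zero => simp [averagingSeq]
  | succ n ih =>
    simp only [averagingSeq, ih]
    rcases lt_or_ge n N with h | h
    · rw [min_eq_left h.le, min_eq_left (Nat.succ_le_of_lt h), hD]
      simp [stoppedStep, hlt n h]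
    · have hle : s ≤ ∑ j ∈ Finset.range n, a j ω :=
        hN.trans (Finset.sum_le_sum_of_subset_of_nonneg (Finset.range_mono h) fun i _ _ => h0 i)
      rw [min_eq_right h, min_eq_right (h.trans n.le_succ)]
      simp [stoppedStep, not_lt.2 hle]

variable {mΩ : MeasurableSpace Ω} {P : Measure Ω} [IsProbabilityMeasure P] {𝔽 : Filtration ℕ mΩ}
  [SecondCountableTopology E] [MeasurableSpace E] [BorelSpace E] [CompleteSpace E]

/-- Second moment of an averaging process at the first time `N` at which the sum of the steps
reaches `s`. -/
theorem integral_norm_sq_at_hitting_le {a : ℕ → Ω → ℝ} {Y D : ℕ → Ω → E} {C s : ℝ}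
    (hC : 0 ≤ C) (hs : 0 ≤ s)
    (ha : ∀ n, Measurable[𝔽 n] (a n)) (ha0 : ∀ n ω, 0 ≤ a n ω) (ha1 : ∀ n ω, a n ω ≤ 1)
    (hanti : ∀ᵐ ω ∂P, Antitone fun n => a n ω)
    (hY : ∀ n, Measurable[𝔽 (n + 1)] (Y n)) (hYC : ∀ᵐ ω ∂P, ∀ n, ‖Y n ω‖ ≤ C)
    (hY0 : ∀ n, ∫ ω, Y n ω ∂P = 0)
    (hindep : ∀ n, Indep (MeasurableSpace.comap (Y n) inferInstance) (𝔽 n) P)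
    (hD₀ : Measurable[𝔽 0] (D 0)) (hD₀2 : Integrable (fun ω => ‖D 0 ω‖ ^ 2) P)
    (hD : ∀ᵐ ω ∂P, ∀ n, D (n + 1) ω = (1 - a n ω) • D n ω + a n ω • Y n ω)
    {N : Ω → ℕ} (hN : ∀ᵐ ω ∂P, (∀ n < N ω, ∑ j ∈ Finset.range n, a j ω < s) ∧
      s ≤ ∑ j ∈ Finset.range (N ω), a j ω) :
    Integrable (fun ω => ‖D (N ω) ω‖ ^ 2) P ∧
    ∀ K : ℕ, ∫ ω, ‖D (N ω) ω‖ ^ 2 ∂P ≤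
      Real.exp (-s) * (∫ ω, ‖D 0 ω‖ ^ 2 ∂P + C ^ 2 * (K * Real.exp K))
        + C ^ 2 * Real.exp 2 * ∫ ω, a K ω ∂P := by
  set b : ℕ → Ω → ℝ := fun k ω => stoppedStep (fun j => a j ω) s k with hb
  set D' := averagingSeq b Y (D 0) with hD'
  set B : ℕ → Ω → ℝ := fun n ω => ∑ k ∈ Finset.range n, b k ω with hB
  have hb0 : ∀ n ω, 0 ≤ b n ω := fun n ω => stoppedStep_nonneg (fun j => ha0 j ω) s n
  have hb1 : ∀ n ω, b n ω ≤ 1 := fun n ω =>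
    (stoppedStep_le (fun j => ha0 j ω) s n).trans (ha1 n ω)
  have hbm' : ∀ n, Measurable[𝔽 n] (b n) := fun n => by
    have hS : Measurable[𝔽 n] fun ω => ∑ j ∈ Finset.range n, a j ω :=
      Finset.measurable_fun_sum _ fun j hj => (ha j).mono
        (𝔽.mono (Finset.mem_range.1 hj).le) le_rfl
    exact Measurable.ite (measurableSet_lt hS measurable_const) (ha n) measurable_const
  have hbm : ∀ n, Measurable (b n) := fun n => (hbm' n).mono (𝔽.le n) le_rfl
  have hBm : ∀ n, Measurable (B n) := fun n => Finset.measurable_fun_sum _ fun k _ => hbm k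
  have hBs : ∀ n ω, B n ω ≤ s + 1 := fun n ω =>
    sum_stoppedStep_le (fun j => ha0 j ω) (fun j => ha1 j ω) hs n
  have hD'm : ∀ n, Measurable (D' n) := fun n =>
    (measurable_averagingSeq hbm' hY hD₀ n).mono (𝔽.le n) le_rfl
  have hD₀L : MemLp (D 0) 2 P :=
    (memLp_two_iff_integrable_sq_norm (hD₀.mono (𝔽.le 0) le_rfl).aestronglyMeasurable).2 hD₀2
  have hG : Integrable (fun ω => (‖D 0 ω‖ + C) ^ 2) P :=
    (hD₀L.norm.add (memLp_const C)).integrable_sq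
  have hD'b : ∀ᵐ ω ∂P, ∀ n, ‖D' n ω‖ ≤ ‖D 0 ω‖ + C := by
    filter_upwards [hYC] with ω hω n
    exact averagingSeq_norm_le hC (fun n => hb0 n ω) (fun n => hb1 n ω) hω n
  have hD'b2 : ∀ᵐ ω ∂P, ∀ n, ‖D' n ω‖ ^ 2 ≤ (‖D 0 ω‖ + C) ^ 2 := by
    filter_upwards [hD'b] with ω hω n
    exact pow_le_pow_left₀ (norm_nonneg _) (hω n) 2
  have hev : ∀ᵐ ω ∂P, ∀ᶠ n in atTop, s ≤ B n ω ∧ D' n ω = D (N ω) ω := by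
    filter_upwards [hD, hN] with ω hω hNω
    filter_upwards [eventually_ge_atTop (N ω)] with n hn
    refine ⟨le_sum_stoppedStep (fun j => ha0 j ω) (hNω.2.trans ?_), ?_⟩
    · exact Finset.sum_le_sum_of_subset_of_nonneg (Finset.range_mono hn) fun i _ _ => ha0 i ω
    · have := averagingSeq_stoppedStep_eq (fun j => ha0 j ω) hω hNω.1 hNω.2 n
      rwa [min_eq_right hn] at this
  -- The cutoff guarantees a weight of at least `e^s` wherever `F n` is nonzero, and is eventually
  -- inactive. The limit also yields measurability of the stopped value, as `N` is not assumed
  -- measurable.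
  set F : ℕ → Ω → ℝ := fun n ω => if s ≤ B n ω then ‖D' n ω‖ ^ 2 else 0 with hF
  have hFm : ∀ n, Measurable (F n) := fun n =>
    Measurable.ite (measurableSet_le measurable_const (hBm n)) ((hD'm n).norm.pow_const 2)
      measurable_const
  have hFb : ∀ n, ∀ᵐ ω ∂P, ‖F n ω‖ ≤ (‖D 0 ω‖ + C) ^ 2 := fun n => by
    filter_upwards [hD'b2] with ω hω
    simp only [hF]
    split_ifs
    · rw [Real.norm_of_nonneg (sq_nonneg _)]; exact hω n
    · simpa using sq_nonneg _
  have hFlim : ∀ᵐ ω ∂P, Tendsto (fun n => F n ω) atTop (𝓝 (‖D (N ω) ω‖ ^ 2)) := by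
    filter_upwards [hev] with ω hω
    refine tendsto_const_nhds.congr' ?_
    filter_upwards [hω] with n hn
    simp [hF, hn.1, hn.2]
  have hmeas : AEStronglyMeasurable (fun ω => ‖D (N ω) ω‖ ^ 2) P :=
    aestronglyMeasurable_of_tendsto_ae atTop (fun n => (hFm n).aestronglyMeasurable) hFlim
  refine ⟨hG.mono' hmeas ?_, fun K => ?_⟩
  · filter_upwards [hev, hD'b2] with ω hω hb2
    obtain ⟨n, -, hn⟩ := hω.exists
    rw [Real.norm_of_nonneg (sq_nonneg _), ← hn]
    exact hb2 n
  have hFint := tendsto_integral_of_dominated_convergence _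
    (fun n => (hFm n).aestronglyMeasurable) hG hFb hFlim
  refine le_of_tendsto' hFint fun n => ?_
  have hU : Integrable (fun ω => Real.exp (B n ω) * ‖D' n ω‖ ^ 2) P := by
    refine (hG.const_mul (Real.exp (s + 1))).mono'
      ((hBm n).exp.mul ((hD'm n).norm.pow_const 2)).aestronglyMeasurable ?_
    filter_upwards [hD'b2] with ω hω
    rw [Real.norm_of_nonneg (by positivity)]
    exact mul_le_mul (Real.exp_le_exp.2 (hBs n ω)) (hω n) (sq_nonneg _) (Real.exp_pos _).le
  have haK : Integrable (a K) P :=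
    Integrable.of_bound ((ha K).mono (𝔽.le K) le_rfl).aestronglyMeasurable 1
      (ae_of_all _ fun ω => by rw [Real.norm_of_nonneg (ha0 K ω)]; exact ha1 K ω)
  have hmain := integral_exp_mul_norm_averagingSeq_sq_le (P := P) hC hbm' hb0 hb1 hY hYC hY0
    hindep hD₀ hD₀2 n
  have hsum : ∫ ω, ∑ k ∈ Finset.range n,
      Real.exp (∑ j ∈ Finset.range (k + 1), b j ω) * b k ω ^ 2 ∂P
      ≤ K * Real.exp K + Real.exp (s + 2) * ∫ ω, a K ω ∂P := by
    calc _ ≤ ∫ ω, (K * Real.exp K + Real.exp (s + 2) * a K ω) ∂P := by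
          refine integral_mono_of_nonneg (ae_of_all _ fun ω => ?_)
            ((integrable_const _).add (haK.const_mul _)) ?_
          · exact Finset.sum_nonneg fun k _ => by positivity
          · filter_upwards [hanti] with ω hω
            exact sum_exp_mul_stoppedStep_sq_le (fun j => ha0 j ω) (fun j => ha1 j ω) hω hs K n
      _ = _ := by
          rw [integral_add (integrable_const _) (haK.const_mul _)]
          simp [integral_const_mul]
  have hFU : ∫ ω, F n ω ∂P ≤ Real.exp (-s) * ∫ ω, Real.exp (B n ω) * ‖D' n ω‖ ^ 2 ∂P := by
    rw [← integral_const_mul]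
    refine integral_mono_ae (hG.mono' (hFm n).aestronglyMeasurable (hFb n)) (hU.const_mul _)
      (ae_of_all _ fun ω => ?_)
    simp only [hF]
    split_ifs with h
    · rw [← mul_assoc, ← Real.exp_add]
      exact le_mul_of_one_le_left (sq_nonneg _) (Real.one_le_exp (by linarith))
    · positivity
  have hexp : Real.exp (-s) * Real.exp (s + 2) = Real.exp 2 := by rw [← Real.exp_add]; ring_nf
  calc ∫ ω, F n ω ∂P ≤ Real.exp (-s) * (∫ ω, ‖D 0 ω‖ ^ 2 ∂P
        + C ^ 2 * (K * Real.exp K + Real.exp (s + 2) * ∫ ω, a K ω ∂P)) := by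
        refine hFU.trans (mul_le_mul_of_nonneg_left (hmain.trans ?_) (Real.exp_pos _).le)
        gcongr
    _ = _ := by rw [← hexp]; ring

/-- If the steps moreover tend to zero, then the second moment at the hitting time of `s` tends to
zero as `s → ∞`. -/
theorem tendsto_integral_norm_sq_at_hitting {a : ℕ → Ω → ℝ} {Y D : ℕ → Ω → E} {C : ℝ}
    (hC : 0 ≤ C)
    (ha : ∀ n, Measurable[𝔽 n] (a n)) (ha0 : ∀ n ω, 0 ≤ a n ω) (ha1 : ∀ n ω, a n ω ≤ 1)
    (hanti : ∀ᵐ ω ∂P, Antitone fun n => a n ω)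
    (halim : ∀ᵐ ω ∂P, Tendsto (fun n => a n ω) atTop (𝓝 0))
    (hY : ∀ n, Measurable[𝔽 (n + 1)] (Y n)) (hYC : ∀ᵐ ω ∂P, ∀ n, ‖Y n ω‖ ≤ C)
    (hY0 : ∀ n, ∫ ω, Y n ω ∂P = 0)
    (hindep : ∀ n, Indep (MeasurableSpace.comap (Y n) inferInstance) (𝔽 n) P)
    (hD₀ : Measurable[𝔽 0] (D 0)) (hD₀2 : Integrable (fun ω => ‖D 0 ω‖ ^ 2) P)
    (hD : ∀ᵐ ω ∂P, ∀ n, D (n + 1) ω = (1 - a n ω) • D n ω + a n ω • Y n ω)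
    {N : ℝ → Ω → ℕ} (hN : ∀ s, 0 ≤ s → ∀ᵐ ω ∂P,
      (∀ n < N s ω, ∑ j ∈ Finset.range n, a j ω < s) ∧
        s ≤ ∑ j ∈ Finset.range (N s ω), a j ω) :
    Tendsto (fun s => ∫ ω, ‖D (N s ω) ω‖ ^ 2 ∂P) atTop (𝓝 0) := by
  have hα : Tendsto (fun K => C ^ 2 * Real.exp 2 * ∫ ω, a K ω ∂P) atTop (𝓝 0) := by
    have h := tendsto_integral_of_dominated_convergence (μ := P) (F := a) (f := fun _ => 0)
      (fun _ => 1) (fun n => ((ha n).mono (𝔽.le n) le_rfl).aestronglyMeasurable)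
      (integrable_const _)
      (fun n => ae_of_all _ fun ω => by rw [Real.norm_of_nonneg (ha0 n ω)]; exact ha1 n ω) halim
    simpa using h.const_mul (C ^ 2 * Real.exp 2)
  rw [tendsto_order]
  refine ⟨fun x hx => Eventually.of_forall fun s =>
    hx.trans_le (integral_nonneg fun ω => sq_nonneg _), fun ε hε => ?_⟩
  -- The order matters: `K` is fixed before `s` grows.
  obtain ⟨K, hK⟩ := (hα.eventually (gt_mem_nhds (half_pos hε))).exists
  have he : Tendsto (fun s => Real.exp (-s) *
      (∫ ω, ‖D 0 ω‖ ^ 2 ∂P + C ^ 2 * (K * Real.exp K))) atTop (𝓝 0) := by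
    simpa using Real.tendsto_exp_neg_atTop_nhds_zero.mul_const
      (∫ ω, ‖D 0 ω‖ ^ 2 ∂P + C ^ 2 * (K * Real.exp K))
  filter_upwards [he.eventually (gt_mem_nhds (half_pos hε)), eventually_ge_atTop 0] with s h1 hs
  have := (integral_norm_sq_at_hitting_le hC hs ha ha0 ha1 hanti hY hYC hY0 hindep hD₀ hD₀2 hD
    (hN s hs)).2 K
  linarith

end Stopping

/-! ### Application to stochastic gradient descent -/

/-- An antitone real sequence whose upper limit is zero is nonnegative and tends to zero. -/
theorem Antitone.nonneg_and_tendsto_zero_of_limsup_eq_zero {u : ℕ → ℝ} (hu : Antitone u)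
    (h : limsup (fun n => (u n : EReal)) atTop = 0) :
    (∀ n, 0 ≤ u n) ∧ Tendsto u atTop (𝓝 0) := by
  have hu' : Antitone fun n => (u n : EReal) := fun i j hij => EReal.coe_le_coe_iff.2 (hu hij)
  have ht := tendsto_atTop_iInf hu'
  have h0 : ⨅ n, (u n : EReal) = 0 := ht.limsup_eq.symm.trans h
  rw [h0] at ht
  refine ⟨fun n => ?_, ?_⟩
  · have : (0 : EReal) ≤ u n := h0 ▸ iInf_le (fun n => (u n : EReal)) n
    exact_mod_cast this
  · exact EReal.tendsto_coe.1 (by simpa using ht)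

/-- Partial sums of a nonnegative sequence with infinite sum are unbounded. -/
theorem exists_le_sum_of_tsum_ofReal_eq_top {u : ℕ → ℝ} (h0 : ∀ n, 0 ≤ u n)
    (h : ∑' n, ENNReal.ofReal (u n) = ⊤) (t : ℝ) : ∃ n, t ≤ ∑ k ∈ Finset.range n, u k := by
  by_contra! hcon
  have hle : ∑' n, ENNReal.ofReal (u n) ≤ ENNReal.ofReal t := by
    rw [ENNReal.tsum_eq_iSup_nat]
    refine iSup_le fun n => ?_
    rw [← ENNReal.ofReal_sum_of_nonneg fun i _ => h0 i]
    exact ENNReal.ofReal_le_ofReal (hcon n).le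
  exact absurd (h ▸ hle) (by simp)

theorem mainTheorem5
    (ϑ : ℝ) (hϑ : 0 < ϑ) (d : ℕ) (hd : 0 < d)
    -- the quadratic loss function
    (l : EuclideanSpace ℝ (Fin d) → EuclideanSpace ℝ (Fin d) → ℝ)
    (hl : ∀ θ x, l θ x = ϑ / 2 * ‖θ - x‖ ^ 2)
    -- the filtered probability space
    {Ω : Type*} {mΩ : MeasurableSpace Ω} (P : Measure Ω) [IsProbabilityMeasure P]
    (𝔽 : Filtration ℕ mΩ)
    -- the step sizes `γ n` for `1 ≤ n` (the value `γ 0` is never used)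
    (γ : ℕ → Ω → ℝ)
    (hγ_meas : ∀ n, Measurable[𝔽 n] (γ (n + 1)))
    (hγ_lim : ∀ᵐ ω ∂P, limsup (fun n => (γ (n + 1) ω : EReal)) atTop = 0)
    (hγ_sum : ∀ᵐ ω ∂P, ∑' n, ENNReal.ofReal |γ (n + 1) ω| = ⊤)
    (hγ_mono : ∀ n, 1 ≤ n → ∀ᵐ ω ∂P, γ (n + 1) ω ≤ γ n ω ∧ γ n ω ≤ ϑ⁻¹)
    -- the i.i.d. data `X n m` for `1 ≤ n` and `M` values of `m` (the value `X 0` is never used)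
    (M : ℕ) (hM : 0 < M)
    (X : ℕ → Fin M → Ω → EuclideanSpace ℝ (Fin d))
    (hX_indep : iIndepFun (fun p : ℕ × Fin M => X (p.1 + 1) p.2) P)
    (hX_ident : ∀ n m, IdentDistrib (X (n + 1) m) (X 1 ⟨0, hM⟩) P P)
    -- the SGD process
    (Θ : ℕ → Ω → EuclideanSpace ℝ (Fin d))
    (hΘ_adapted : Adapted 𝔽 Θ)
    (hΘ_rec : ∀ n ω, Θ (n + 1) ω = Θ n ω - (γ (n + 1) ω / (M : ℝ)) •
      ∑ m, gradient (fun θ => l θ (X (n + 1) m ω)) (Θ n ω))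
    (hX_meas : ∀ n m, Measurable[𝔽 (n + 1)] (X (n + 1) m))
    (hX_past : ∀ n,
      Indep (⨆ m, MeasurableSpace.comap (X (n + 1) m) inferInstance) (𝔽 n) P)
    (hbdd : ∫⁻ ω, (ENNReal.ofReal (‖Θ 0 ω‖ ^ 2)
      + ⨆ n, ENNReal.ofReal ‖X (n + 1) ⟨0, hM⟩ ω‖) ∂P < ⊤)
    -- `N t` is the first index at which the accumulated step sizes reach `t`
    (N : ℝ → Ω → ℕ)
    (hN : ∀ t, 0 ≤ t → ∀ ω, (∃ n, t ≤ ∑ k ∈ Finset.Icc 1 n, γ k ω) →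
      N t ω = sInf {n : ℕ | t ≤ ∑ k ∈ Finset.Icc 1 n, γ k ω}) :
    Integrable (X 1 ⟨0, hM⟩) P ∧
    (∀ t, 0 ≤ t →
      Integrable (fun ω => ‖Θ (N t ω) ω - ∫ ω', X 1 ⟨0, hM⟩ ω' ∂P‖ ^ 2) P) ∧
    Tendsto (fun t : ℝ => ∫ ω, ‖Θ (N t ω) ω - ∫ ω', X 1 ⟨0, hM⟩ ω' ∂P‖ ^ 2 ∂P)
      atTop (𝓝 0) := by
  have hMR : (M : ℝ) ≠ 0 := Nat.cast_ne_zero.2 hM.ne'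
  have hΘ₀ : Measurable[𝔽 0] (Θ 0) := hΘ_adapted 0
  have hXm : ∀ n m, Measurable (X (n + 1) m) := fun n m => (hX_meas n m).mono (𝔽.le _) le_rfl
  -- the data are essentially bounded
  obtain ⟨C₀, hC₀, hX₀⟩ := exists_ae_norm_le_of_lintegral_iSup_lt_top
    (X := fun n => X (n + 1) ⟨0, hM⟩) (P := P)
    (hX_indep.precomp (g := fun n : ℕ => (n, (⟨0, hM⟩ : Fin M))) fun i j h => congrArg Prod.fst h)
    (fun n => hX_ident n _)
    (lt_of_le_of_lt (lintegral_mono fun ω => le_add_self) hbdd)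
  have hXC : ∀ n m, ∀ᵐ ω ∂P, ‖X (n + 1) m ω‖ ≤ C₀ := fun n m =>
    (hX_ident n m).symm.ae_snd (measurableSet_le measurable_norm measurable_const) hX₀
  have hXi : ∀ n m, Integrable (X (n + 1) m) P := fun n m =>
    Integrable.of_bound (hXm n m).aestronglyMeasurable C₀ (hXC n m)
  have hX1 : Integrable (X 1 ⟨0, hM⟩) P := hXi 0 _
  refine ⟨hX1, ?_⟩
  set ξ := ∫ ω', X 1 ⟨0, hM⟩ ω' ∂P with hξ
  have hXξ : ∀ n m, ∫ ω, X (n + 1) m ω ∂P = ξ := fun n m => (hX_ident n m).integral_eq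
  -- the normalized steps, innovations and errors
  set a : ℕ → Ω → ℝ := fun n ω => max 0 (min 1 (ϑ * γ (n + 1) ω)) with ha
  set Y : ℕ → Ω → EuclideanSpace ℝ (Fin d) :=
    fun n ω => (M : ℝ)⁻¹ • ∑ m, X (n + 1) m ω - ξ with hY
  set D : ℕ → Ω → EuclideanSpace ℝ (Fin d) := fun n ω => Θ n ω - ξ with hD
  have hγ : ∀ᵐ ω ∂P, (∀ n, a n ω = ϑ * γ (n + 1) ω) ∧ (∀ n, 0 ≤ γ (n + 1) ω) ∧
      (Antitone fun n => γ (n + 1) ω) ∧ Tendsto (fun n => γ (n + 1) ω) atTop (𝓝 0) := by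
    have hmono : ∀ᵐ ω ∂P, ∀ n, γ (n + 1 + 1) ω ≤ γ (n + 1) ω ∧ γ (n + 1) ω ≤ ϑ⁻¹ :=
      ae_all_iff.2 fun n => hγ_mono (n + 1) n.succ_pos
    filter_upwards [hγ_lim, hmono] with ω h1 h2
    have hanti : Antitone fun n => γ (n + 1) ω := antitone_nat_of_succ_le fun n => (h2 n).1
    obtain ⟨h3, h4⟩ := hanti.nonneg_and_tendsto_zero_of_limsup_eq_zero h1
    refine ⟨fun n => ?_, h3, hanti, h4⟩
    have h5 : ϑ * γ (n + 1) ω ≤ 1 := by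
      calc _ ≤ ϑ * ϑ⁻¹ := mul_le_mul_of_nonneg_left (h2 n).2 hϑ.le
        _ = 1 := mul_inv_cancel₀ hϑ.ne'
    simp only [ha]
    rw [min_eq_right h5, max_eq_right (mul_nonneg hϑ.le (h3 n))]
  have ha0 : ∀ n ω, 0 ≤ a n ω := fun n ω => le_max_left _ _
  have ha1 : ∀ n ω, a n ω ≤ 1 := fun n ω => max_le zero_le_one (min_le_left _ _)
  have ham : ∀ n, Measurable[𝔽 n] (a n) := fun n =>
    measurable_const.max (measurable_const.min ((hγ_meas n).const_mul ϑ))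
  have hanti : ∀ᵐ ω ∂P, Antitone fun n => a n ω := by
    filter_upwards [hγ] with ω h i j hij
    simp only [h.1]
    exact mul_le_mul_of_nonneg_left (h.2.2.1 hij) hϑ.le
  have halim : ∀ᵐ ω ∂P, Tendsto (fun n => a n ω) atTop (𝓝 0) := by
    filter_upwards [hγ] with ω h
    simp only [h.1]
    simpa using h.2.2.2.const_mul ϑ
  have hYm : ∀ n, Measurable[𝔽 (n + 1)] (Y n) := fun n =>
    ((Finset.measurable_fun_sum Finset.univ fun m _ => hX_meas n m).const_smul
      (M : ℝ)⁻¹).sub_const ξ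
  have hYC : ∀ᵐ ω ∂P, ∀ n, ‖Y n ω‖ ≤ C₀ + ‖ξ‖ := by
    have : ∀ᵐ ω ∂P, ∀ n m, ‖X (n + 1) m ω‖ ≤ C₀ :=
      ae_all_iff.2 fun n => ae_all_iff.2 fun m => hXC n m
    filter_upwards [this] with ω hω n
    refine (norm_sub_le _ _).trans (add_le_add_left ?_ _)
    rw [norm_smul, norm_inv, Real.norm_natCast, inv_mul_le_iff₀ (by positivity)]
    simpa using norm_sum_le_of_le Finset.univ fun m _ => hω n m
  have hY0 : ∀ n, ∫ ω, Y n ω ∂P = 0 := fun n => by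
    have hi : Integrable (fun ω => (M : ℝ)⁻¹ • ∑ m, X (n + 1) m ω) P :=
      (integrable_finsetSum Finset.univ fun m _ => hXi n m).smul (M : ℝ)⁻¹
    simp only [hY]
    rw [integral_sub hi (integrable_const _), integral_smul,
      integral_finsetSum _ fun m _ => hXi n m]
    simp [hXξ, ← Nat.cast_smul_eq_nsmul ℝ, smul_smul, hMR]
  have hindep : ∀ n, Indep (MeasurableSpace.comap (Y n) inferInstance) (𝔽 n) P := fun n => by
    refine indep_of_indep_of_le_left (hX_past n) (Measurable.comap_le ?_)
    refine ((Finset.measurable_fun_sum Finset.univ fun m _ => ?_).const_smul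
      (M : ℝ)⁻¹).sub_const ξ
    exact (comap_measurable _).mono (le_iSup
      (fun m => MeasurableSpace.comap (X (n + 1) m) inferInstance) m) le_rfl
  have hD₀ : Measurable[𝔽 0] (D 0) := hΘ₀.sub_const _
  have hD₀2 : Integrable (fun ω => ‖D 0 ω‖ ^ 2) P := by
    have hm : AEStronglyMeasurable (Θ 0) P := (hΘ₀.mono (𝔽.le 0) le_rfl).aestronglyMeasurable
    have hΘ2 : Integrable (fun ω => ‖Θ 0 ω‖ ^ 2) P := by
      refine ⟨hm.norm.pow 2, ?_⟩
      rw [hasFiniteIntegral_iff_ofReal (ae_of_all _ fun ω => sq_nonneg _)]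
      exact lt_of_le_of_lt (lintegral_mono fun ω => le_self_add) hbdd
    have := ((memLp_two_iff_integrable_sq_norm hm).2 hΘ2).sub (memLp_const ξ)
    exact this.norm.integrable_sq
  have hDrec : ∀ᵐ ω ∂P, ∀ n, D (n + 1) ω = (1 - a n ω) • D n ω + a n ω • Y n ω := by
    have hgrad : ∀ x θ, gradient (fun θ => l θ x) θ = ϑ • (θ - x) := fun x θ => by
      simp only [hl]
      exact gradient_half_mul_norm_sub_sq ϑ x θ
    filter_upwards [hγ] with ω h n
    have hsum : ∑ m, ϑ • (Θ n ω - X (n + 1) m ω)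
        = ϑ • ((M : ℝ) • Θ n ω - ∑ m, X (n + 1) m ω) := by
      rw [← Finset.smul_sum, Finset.sum_sub_distrib]
      simp [← Nat.cast_smul_eq_nsmul ℝ]
    simp only [hD, hY, h.1, hΘ_rec, hgrad, hsum]
    match_scalars <;> field_simp
    ring
  -- Sums of `a` are `ϑ` times sums of `γ`, so level `s` for `a` is level `ϑ⁻¹ * s` for `γ`.
  have hNhit : ∀ s, 0 ≤ s → ∀ᵐ ω ∂P,
      (∀ n < N (ϑ⁻¹ * s) ω, ∑ j ∈ Finset.range n, a j ω < s) ∧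
        s ≤ ∑ j ∈ Finset.range (N (ϑ⁻¹ * s) ω), a j ω := by
    intro s hs
    filter_upwards [hγ, hγ_sum] with ω h htop
    have hS : ∀ n, ∑ j ∈ Finset.range n, a j ω = ϑ * ∑ k ∈ Finset.Icc 1 n, γ k ω := fun n => by
      induction n with
      | zero => simp
      | succ n ih =>
        rw [Finset.sum_range_succ, ih, h.1, Finset.sum_Icc_succ_top (Nat.le_add_left 1 n), mul_add]
    have hiff : ∀ n, s ≤ ∑ j ∈ Finset.range n, a j ω ↔
        ϑ⁻¹ * s ≤ ∑ k ∈ Finset.Icc 1 n, γ k ω := fun n => by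
      rw [hS, inv_mul_le_iff₀ hϑ]
    have htop' : ∑' n, ENNReal.ofReal (ϑ * γ (n + 1) ω) = ⊤ := by
      simp only [ENNReal.ofReal_mul hϑ.le, ENNReal.tsum_mul_left]
      simp only [abs_of_nonneg (h.2.1 _)] at htop
      rw [htop, ENNReal.mul_top (by simpa using hϑ)]
    obtain ⟨n₀, hn₀⟩ := exists_le_sum_of_tsum_ofReal_eq_top
      (fun n => mul_nonneg hϑ.le (h.2.1 n)) htop' s
    simp only [← h.1] at hn₀
    have hne : {n : ℕ | ϑ⁻¹ * s ≤ ∑ k ∈ Finset.Icc 1 n, γ k ω}.Nonempty := ⟨n₀, (hiff n₀).1 hn₀⟩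
    rw [hN _ (by positivity) ω hne]
    refine ⟨fun n hn => ?_, (hiff _).2 (Nat.sInf_mem hne)⟩
    rw [← not_le, hiff]
    exact Nat.notMem_of_lt_sInf hn
  have hC : 0 ≤ C₀ + ‖ξ‖ := by positivity
  constructor
  · intro t ht
    have hs : 0 ≤ ϑ * t := by positivity
    have := (integral_norm_sq_at_hitting_le hC hs ham ha0 ha1 hanti hYm hYC hY0 hindep hD₀ hD₀2
      hDrec (hNhit _ hs)).1
    simpa only [inv_mul_cancel_left₀ hϑ.ne'] using this
  · have := (tendsto_integral_norm_sq_at_hitting hC ham ha0 ha1 hanti halim hYm hYC hY0 hindep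
      hD₀ hD₀2 hDrec hNhit).comp (tendsto_id.const_mul_atTop hϑ)
    simpa only [Function.comp_def, id, inv_mul_cancel_left₀ hϑ.ne'] using this
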